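/- A \emph{continuum} is a compact connected Hausdorff space with more than one point. A \emph{subcontinuum} of a continuum $X$ is a nonempty closed connected subset (one-point sets are allowed). A point $p\in X$ is a \emph{non-block point} if there is a family of subcontinua of $X$, all contained in $X\setminus\{p\}$, whose intersection is nonempty and whose union is dense in $X$. Let $d(X)$ denote the least cardinality of a dense subset of $X$. For a cardinal $\alpha$, $X$ is \emph{$\alpha$-Baire} if every (indexed) family of $\alpha$ many open dense subsets of $X$ has dense intersection. \textbf{Theorem.} Let $X$ be a continuum that is $d(X)$-Baire. Then $X$ is irreducible about its set of non-block points: no proper subcontinuum of $X$ contains every non-block point of $X$. Moreover $X$ has at least two non-block points. Every separable continuum $X$ is $d(X)$-Baire; in particular these conclusions hold for every separable continuum. -/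

import Mathlib

universe u

namespace HausdorffContinua

/-- A subcontinuum of `X`: a nonempty closed connected subset. In a compact Hausdorff space these
are exactly the subsets which are continua in the subspace topology; one-point subsets are
allowed. -/
def IsSubcontinuum {X : Type u} [TopologicalSpace X] (K : Set X) : Prop :=
  IsClosed K ∧ IsConnected K

/-- `P` is a non-block set of `X`: some family of subcontinua of `X` that are contained in the
complement of `P` has nonempty intersection and dense union. -/
def IsNonBlockSet {X : Type u} [TopologicalSpace X] (P : Set X) : Prop :=
  ∃ F : Set (Set X), (∀ M ∈ F, IsSubcontinuum M ∧ M ⊆ Pᶜ) ∧ (⋂₀ F).Nonempty ∧ Dense (⋃₀ F)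

/-- A non-block point is a point `p` such that `{p}` is a non-block set. -/
def IsNonBlockPoint {X : Type u} [TopologicalSpace X] (p : X) : Prop :=
  IsNonBlockSet ({p} : Set X)

/-- `X` is irreducible about `S`: no proper subcontinuum of `X` contains `S`. -/
def IsIrreducibleAbout {X : Type u} [TopologicalSpace X] (S : Set X) : Prop :=
  ∀ K : Set X, IsSubcontinuum K → S ⊆ K → K = Set.univ

/-- The density `d(X)`: the least cardinality of a dense subset of `X`. -/
noncomputable def density (X : Type u) [TopologicalSpace X] : Cardinal.{u} :=
  sInf {κ : Cardinal.{u} | ∃ D : Set X, Dense D ∧ Cardinal.mk D = κ}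

/-- `X` is `α`-Baire: every family of `α` many open dense subsets has dense intersection. -/
def IsCardinalBaire (X : Type u) [TopologicalSpace X] (α : Cardinal.{u}) : Prop :=
  ∀ (ι : Type u) (U : ι → Set X), Cardinal.mk ι = α →
    (∀ i, IsOpen (U i) ∧ Dense (U i)) → Dense (⋂ i, U i)

end HausdorffContinua

/-! Suppose the subcontinuum K is proper; a non-block point is sought outside K. If every proper
subcontinuum around K lies in the interior of another, a maximal chain for that relation has dense
union, which by compactness is not all of X, and any point it misses works. Otherwise some proper L
⊇ K is interior to no proper subcontinuum. If all points off L block, boundary bumping shows that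
for each d the points unavoidable between L and d are nowhere dense off L. The Baire hypothesis,
applied over a dense set of d(X) many d, gives p off L avoidable for all of them, hence non-block: a
contradiction. Two points arise by taking singletons for K. -/

namespace HausdorffContinua

open Set Topology

section Bumping

variable {X : Type u} [TopologicalSpace X] [CompactSpace X] [T2Space X]

/-- In a compact Hausdorff space, a component of a closed set `F` can be separated from any
disjoint closed set by a relatively clopen subset of `F`. -/
theorem exists_relatively_clopen_disjoint {F G : Set X} {x : X} (hF : IsClosed F) (hx : x ∈ F)
    (hG : IsClosed G) (h : Disjoint (connectedComponentIn F x) G) :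
    ∃ O : Set X, IsOpen O ∧ IsClosed (F ∩ O) ∧ connectedComponentIn F x ⊆ O ∧
      Disjoint (F ∩ O) G := by
  have : CompactSpace F := isCompact_iff_compactSpace.mp hF.isCompact
  have hcomp : connectedComponent (⟨x, hx⟩ : F) ⊆ (Subtype.val ⁻¹' G : Set F)ᶜ := by
    intro y hy hyG
    refine Set.disjoint_left.mp h ?_ hyG
    rw [connectedComponentIn_eq_image hx]
    exact ⟨y, hy, rfl⟩
  have hopen : IsOpen (Subtype.val ⁻¹' G : Set F)ᶜ :=
    (hG.preimage continuous_subtype_val).isOpen_compl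
  rw [connectedComponent_eq_iInter_isClopen] at hcomp
  have : Nonempty { s : Set F // IsClopen s ∧ (⟨x, hx⟩ : F) ∈ s } :=
    ⟨⟨univ, isClopen_univ, mem_univ _⟩⟩
  obtain ⟨Z, hZ⟩ := exists_subset_nhds_of_isCompact'
    (V := fun s : { s : Set F // IsClopen s ∧ (⟨x, hx⟩ : F) ∈ s } => (s : Set F))
    (by
      intro a b
      exact ⟨⟨a.1 ∩ b.1, a.2.1.inter b.2.1, a.2.2, b.2.2⟩, inter_subset_left, inter_subset_right⟩)
    (fun s => s.2.1.isClosed.isCompact) (fun s => s.2.1.isClosed)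
    (fun y hy => hopen.mem_nhds (hcomp hy))
  obtain ⟨O, hO, hOZ⟩ := isOpen_induced_iff.mp Z.2.1.isOpen
  have hFO : F ∩ O = Subtype.val '' Z.1 := by
    rw [← hOZ, Subtype.image_preimage_coe]
  refine ⟨O, hO, ?_, ?_, ?_⟩
  · rw [hFO]
    exact hF.isClosedEmbedding_subtypeVal.isClosedMap _ Z.2.1.isClosed
  · rw [connectedComponentIn_eq_image hx]
    rintro _ ⟨y, hy, rfl⟩
    have : y ∈ Z.1 := Z.2.1.connectedComponent_subset Z.2.2 hy
    rw [← hOZ] at this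
    exact this
  · rw [hFO, Set.disjoint_left]
    rintro _ ⟨y, hy, rfl⟩ hyG
    exact hZ hy hyG

/-- Boundary bumping: every component of the complement of a nonempty open set `U` of a continuum
meets the closure of `U`. -/
theorem connectedComponentIn_compl_inter_closure_nonempty [ConnectedSpace X] {U : Set X} {x : X}
    (hU : IsOpen U) (hne : U.Nonempty) (hx : x ∉ U) :
    (connectedComponentIn Uᶜ x ∩ closure U).Nonempty := by
  by_contra hcon
  obtain ⟨O, hO, hcl, hsub, hdis⟩ := exists_relatively_clopen_disjoint hU.isClosed_compl hx
    isClosed_closure (Set.disjoint_iff_inter_eq_empty.mpr (Set.not_nonempty_iff_eq_empty.mp hcon))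
  have heq : Uᶜ ∩ O = (closure U)ᶜ ∩ O := by
    ext y
    refine ⟨fun hy => ⟨fun hyc => Set.disjoint_left.mp hdis hy hyc, hy.2⟩, fun hy =>
      ⟨fun hyU => hy.1 (subset_closure hyU), hy.2⟩⟩
  have hclopen : IsClopen (Uᶜ ∩ O) :=
    ⟨hcl, heq ▸ isClosed_closure.isOpen_compl.inter hO⟩
  obtain ⟨y, hy⟩ := hne
  have hmem : y ∈ Uᶜ ∩ O := by
    rw [hclopen.eq_univ ⟨x, hx, hsub (mem_connectedComponentIn hx)⟩]
    trivial
  exact hmem.1 hy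

end Bumping

theorem isClosed_connectedComponentIn {Y : Type u} [TopologicalSpace Y] {F : Set Y}
    (hF : IsClosed F) (x : Y) : IsClosed (connectedComponentIn F x) := by
  by_cases hx : x ∈ F
  · refine isClosed_of_closure_subset ?_
    exact isPreconnected_connectedComponentIn.closure.subset_connectedComponentIn
      (subset_closure (mem_connectedComponentIn hx))
      (closure_minimal (connectedComponentIn_subset F x) hF)
  · rw [connectedComponentIn_eq_empty hx]
    exact isClosed_empty

/-! ### Joining a subcontinuum to points while avoiding p -/

section Avoiding

variable {X : Type u} [TopologicalSpace X]

/-- The union of all subcontinua that contain `K` and miss `p`. -/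
def reachableAvoiding (K : Set X) (p : X) : Set X :=
  ⋃₀ {M | IsSubcontinuum M ∧ K ⊆ M ∧ p ∉ M}

/-- The intersection of all subcontinua that contain `K` and the point `d`. -/
def unavoidable (K : Set X) (d : X) : Set X :=
  ⋂₀ {M | IsSubcontinuum M ∧ K ⊆ M ∧ d ∈ M}

theorem isClosed_unavoidable (K : Set X) (d : X) : IsClosed (unavoidable K d) :=
  isClosed_sInter fun _ hM => hM.1.1

theorem unavoidable_of_mem {K : Set X} {d : X} (hK : IsSubcontinuum K) (hd : d ∈ K) :
    unavoidable K d ⊆ K :=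
  sInter_subset_of_mem ⟨hK, Subset.rfl, hd⟩

theorem mem_reachableAvoiding_of_notMem_unavoidable {K : Set X} {p d : X}
    (h : p ∉ unavoidable K d) : d ∈ reachableAvoiding K p := by
  simp only [unavoidable, mem_sInter, not_forall] at h
  obtain ⟨M, hM, hp⟩ := h
  exact ⟨M, ⟨hM.1, hM.2.1, hp⟩, hM.2.2⟩

theorem isNonBlockPoint_of_dense_reachableAvoiding {K : Set X} {p : X} (hK : K.Nonempty)
    (h : Dense (reachableAvoiding K p)) : IsNonBlockPoint p := by
  refine ⟨_, fun M hM => ⟨hM.1, subset_compl_singleton_iff.mpr hM.2.2⟩, ?_, h⟩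
  obtain ⟨x, hx⟩ := hK
  exact ⟨x, fun M hM => hM.2.1 hx⟩

theorem IsSubcontinuum.closure_reachableAvoiding {K : Set X} {p : X} (hK : IsSubcontinuum K)
    (hp : p ∉ K) : IsSubcontinuum (closure (reachableAvoiding K p)) := by
  obtain ⟨x, hx⟩ := hK.2.nonempty
  refine ⟨isClosed_closure, ⟨⟨x, subset_closure ⟨K, ⟨hK, Subset.rfl, hp⟩, hx⟩⟩, ?_⟩⟩
  exact (isPreconnected_sUnion x _ (fun M hM => hM.2.1 hx)
    (fun M hM => hM.1.2.isPreconnected)).closure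

/-- Remove a small open neighbourhood of p: the component of K in the rest misses p, yet bumps into
the closure of that neighbourhood. -/
theorem mem_closure_reachableAvoiding [CompactSpace X] [T2Space X] [ConnectedSpace X]
    {K : Set X} {p : X} (hK : IsSubcontinuum K) (hp : p ∉ K) :
    p ∈ closure (reachableAvoiding K p) := by
  rw [mem_closure_iff_nhds]
  intro N hN
  obtain ⟨T, hT, hTcl, hTN⟩ :=
    exists_mem_nhds_isClosed_subset (Filter.inter_mem hN (hK.1.isOpen_compl.mem_nhds hp))
  obtain ⟨x, hx⟩ := hK.2.nonempty
  have hpT : p ∈ interior T := mem_interior_iff_mem_nhds.mpr hT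
  have hKT : K ⊆ (interior T)ᶜ := fun y hy hyT => (hTN (interior_subset hyT)).2 hy
  obtain ⟨y, hyC, hyT⟩ := connectedComponentIn_compl_inter_closure_nonempty isOpen_interior
    ⟨p, hpT⟩ (hKT hx)
  refine ⟨y, (hTN (closure_minimal interior_subset hTcl hyT)).1, _, ⟨⟨?_, ?_⟩, ?_, ?_⟩, hyC⟩
  · exact isClosed_connectedComponentIn isOpen_interior.isClosed_compl _
  · exact isConnected_connectedComponentIn_iff.mpr (hKT hx)
  · exact hK.2.isPreconnected.subset_connectedComponentIn hx hKT
  · exact fun h => connectedComponentIn_subset _ _ h hpT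

end Avoiding

/-! ### The two cases and their combination -/

variable {X : Type u} [TopologicalSpace X] [CompactSpace X] [ConnectedSpace X]

/-- If every proper subcontinuum around `K` is interior to another proper one, then a maximal
strictly nested chain of proper subcontinua witnesses a non-block point outside `K`. -/
theorem exists_isNonBlockPoint_of_forall_subset_interior {K : Set X} (hK : IsSubcontinuum K)
    (hKne : K ≠ univ)
    (h : ∀ L, IsSubcontinuum L → K ⊆ L → L ≠ univ →
      ∃ M, IsSubcontinuum M ∧ M ≠ univ ∧ L ⊆ interior M) :
    ∃ p, p ∉ K ∧ IsNonBlockPoint p := by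
  let S := {L : Set X // IsSubcontinuum L ∧ K ⊆ L ∧ L ≠ univ}
  let r : S → S → Prop := fun L M => L.1 ⊆ interior M.1
  obtain ⟨c, hc⟩ : ∃ c, IsMaxChain r c := ⟨_, maxChain_spec⟩
  have hsub : ∀ L M : S, r L M → L.1 ⊆ M.1 := fun _ _ hLM => hLM.trans interior_subset
  have hirr : ∀ L : S, ¬ r L L := fun L hL => L.2.2.2
    (IsClopen.eq_univ ⟨L.2.1.1, subset_interior_iff_isOpen.mp hL⟩ L.2.1.2.nonempty)
  have hadd : ∀ M : S, (∀ L ∈ c, r L M) → M ∈ c := by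
    intro M hM
    have := hc.2 (hc.1.insert fun L hL _ => Or.inr (hM L hL)) (subset_insert M c)
    rw [this]
    exact mem_insert M c
  have hcne : c.Nonempty := by
    by_contra hcon
    rw [not_nonempty_iff_eq_empty] at hcon
    have := hadd ⟨K, hK, Subset.rfl, hKne⟩ (by simp [hcon])
    simp [hcon] at this
  obtain ⟨x, hx⟩ := hK.2.nonempty
  let U : Set X := ⋃₀ (Subtype.val '' c)
  have hLU : ∀ L ∈ c, L.1 ⊆ U := fun L hL => subset_sUnion_of_mem ⟨L, hL, rfl⟩
  obtain ⟨L₀, hL₀⟩ := hcne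
  have hKU : K ⊆ U := L₀.2.2.1.trans (hLU L₀ hL₀)
  have hW : IsSubcontinuum (closure U) := by
    refine ⟨isClosed_closure, ⟨x, subset_closure (hKU hx)⟩, ?_⟩
    refine (isPreconnected_sUnion x _ ?_ ?_).closure
    · rintro _ ⟨L, -, rfl⟩
      exact L.2.2.1 hx
    · rintro _ ⟨L, -, rfl⟩
      exact L.2.1.2.isPreconnected
  -- Otherwise a proper M with `closure U` in its interior extends the chain, so M ⊆ U ⊆ interior M
  -- and M is clopen.
  have hdense : closure U = univ := by
    by_contra hne
    obtain ⟨M, hM, hMne, hWM⟩ := h _ hW (hKU.trans subset_closure) hne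
    let M' : S := ⟨M, hM, (hKU.trans subset_closure).trans (hWM.trans interior_subset), hMne⟩
    have hmem : M' ∈ c := hadd M' fun L hL => ((hLU L hL).trans subset_closure).trans hWM
    exact hirr M' (((hLU M' hmem).trans subset_closure).trans hWM)
  have hUne : U ≠ univ := by
    intro hU
    -- A last member of the chain would equal U. So the interiors of the members already cover X,
    -- and by compactness a single one does.
    have hstep : ∀ L ∈ c, ∃ M ∈ c, r L M := by
      intro L hL
      by_contra! hcon
      refine L.2.2.2 (eq_univ_of_univ_subset (hU.symm.subset.trans ?_))
      rintro y ⟨_, ⟨M, hM, rfl⟩, hy⟩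
      by_cases hML : M = L
      · exact hML ▸ hy
      · exact hsub M L ((hc.1 hM hL hML).resolve_right (hcon M hM)) hy
    have : Nonempty c := ⟨⟨L₀, hL₀⟩⟩
    obtain ⟨L, hL⟩ := isCompact_univ.elim_directed_cover (fun L : c => interior L.1.1)
      (fun _ => isOpen_interior)
      (by
        refine hU.symm.subset.trans ?_
        rintro y ⟨_, ⟨L, hL, rfl⟩, hy⟩
        obtain ⟨M, hM, hLM⟩ := hstep L hL
        exact mem_iUnion.mpr ⟨⟨M, hM⟩, hLM hy⟩)
      (by
        intro L M
        by_cases hLM : L.1 = M.1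
        · exact ⟨M, by simp [hLM], Subset.rfl⟩
        · rcases hc.1 L.2 M.2 hLM with hr | hr
          · exact ⟨M, interior_mono (hsub _ _ hr), Subset.rfl⟩
          · exact ⟨L, Subset.rfl, interior_mono (hsub _ _ hr)⟩)
    exact L.1.2.2.2 (eq_univ_of_univ_subset (hL.trans interior_subset))
  obtain ⟨p, hp⟩ := (ne_univ_iff_exists_notMem U).mp hUne
  refine ⟨p, fun hpK => hp (hKU hpK), _, ?_, ⟨x, ?_⟩, dense_iff_closure_eq.mpr hdense⟩
  · rintro _ ⟨L, hL, rfl⟩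
    exact ⟨L.2.1, subset_compl_singleton_iff.mpr fun hpL => hp (hLU L hL hpL)⟩
  · rintro _ ⟨L, -, rfl⟩
    exact L.2.2.1 hx

/-- If no proper subcontinuum has `L` in its interior and `d` is a block point, then the set of
points outside `L` that cannot be avoided when joining `L` to `d` has empty interior. -/
theorem interior_unavoidable_subset [T2Space X] {L : Set X} (hL : IsSubcontinuum L)
    (h : ∀ M, IsSubcontinuum M → L ⊆ interior M → M = univ) {d : X} (hd : d ∉ L)
    (hblock : ¬ IsNonBlockPoint d) : interior (unavoidable L d) ⊆ L := by
  intro v hv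
  by_contra hvL
  obtain ⟨T, hT, hTcl, hTsub⟩ := exists_mem_nhds_isClosed_subset
    (Filter.inter_mem (isOpen_interior.mem_nhds hv) (hL.1.isOpen_compl.mem_nhds hvL))
  let V := interior T
  have hvV : v ∈ V := mem_interior_iff_mem_nhds.mpr hT
  have hVT : closure V ⊆ T := closure_minimal interior_subset hTcl
  let W := closure (reachableAvoiding L d)
  have hW : IsSubcontinuum W := hL.closure_reachableAvoiding hd
  have hLW : L ⊆ W := fun y hy => subset_closure ⟨L, ⟨hL, Subset.rfl, hd⟩, hy⟩
  have hIW : unavoidable L d ⊆ W :=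
    sInter_subset_of_mem ⟨hW, hLW, mem_closure_reachableAvoiding hL hd⟩
  have hVW : closure V ⊆ W := fun y hy => hIW (interior_subset (hTsub (hVT hy)).1)
  have hWne : W ≠ univ := fun hWu => hblock
    (isNonBlockPoint_of_dense_reachableAvoiding hL.2.nonempty (dense_iff_closure_eq.mpr hWu))
  obtain ⟨y, hy⟩ := (ne_univ_iff_exists_notMem W).mp hWne
  obtain ⟨x, hx⟩ := hL.2.nonempty
  have hLV : L ⊆ Vᶜ := fun z hz hzV => (hTsub (interior_subset hzV)).2 hz
  let C := connectedComponentIn Vᶜ x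
  have hLC : L ⊆ C := hL.2.isPreconnected.subset_connectedComponentIn hx hLV
  have hC : IsSubcontinuum C := ⟨isClosed_connectedComponentIn isOpen_interior.isClosed_compl _,
    isConnected_connectedComponentIn_iff.mpr (hLV hx)⟩
  have hdC : d ∉ C := by
    intro hdC
    have : v ∈ C := (sInter_subset_of_mem ⟨hC, hLC, hdC⟩ : unavoidable L d ⊆ C)
      (interior_subset hv)
    exact connectedComponentIn_subset _ _ this hvV
  have hCW : C ⊆ W := fun z hz => subset_closure ⟨C, ⟨hC, hLC, hdC⟩, hz⟩
  obtain ⟨O, hO, hAcl, hCO, hdis⟩ := exists_relatively_clopen_disjoint (F := Vᶜ) (G := {y})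
    isOpen_interior.isClosed_compl (hLV hx) isClosed_singleton
    (disjoint_singleton_right.mpr fun hyC => hy (hCW hyC))
  -- Each component of `Vᶜ` meeting O stays in O and bumps into `closure V ⊆ W`, so the union is
  -- connected. It misses y but has L in its interior, against `h`.
  have hM : IsSubcontinuum (Vᶜ ∩ O ∪ W) := by
    refine ⟨hAcl.union hW.1, ⟨x, Or.inr (hLW hx)⟩, ?_⟩
    refine isPreconnected_of_forall x fun a ha => ?_
    rcases ha with ha | ha
    · have hmem : a ∈ connectedComponentIn Vᶜ a := mem_connectedComponentIn ha.1
      obtain ⟨z, hzC, hzV⟩ := connectedComponentIn_compl_inter_closure_nonempty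
        isOpen_interior ⟨v, hvV⟩ ha.1
      have hsub : connectedComponentIn Vᶜ a ⊆ O := by
        refine (isPreconnected_iff_subset_of_disjoint.mp isPreconnected_connectedComponentIn O
          (Vᶜ ∩ O)ᶜ hO hAcl.isOpen_compl ?_ ?_).resolve_right fun hs => hs hmem ha
        · intro z _
          by_cases hz : z ∈ O
          · exact Or.inl hz
          · exact Or.inr fun hz' => hz hz'.2
        · refine eq_empty_of_forall_notMem fun z hz => ?_
          exact hz.2.2 ⟨connectedComponentIn_subset _ _ hz.1, hz.2.1⟩
      exact ⟨connectedComponentIn Vᶜ a ∪ W, union_subset_union_left _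
        (subset_inter (connectedComponentIn_subset _ _) hsub), Or.inr (hLW hx), Or.inl hmem,
        IsPreconnected.union z hzC (hVW hzV) isPreconnected_connectedComponentIn
          hW.2.isPreconnected⟩
    · exact ⟨W, subset_union_right, hLW hx, ha, hW.2.isPreconnected⟩
  have hLint : L ⊆ interior (Vᶜ ∩ O ∪ W) := by
    have hopen : IsOpen ((closure V)ᶜ ∩ O) := isClosed_closure.isOpen_compl.inter hO
    refine Subset.trans ?_ (interior_maximal (fun z hz =>
      Or.inl ⟨fun hzV => hz.1 (subset_closure hzV), hz.2⟩) hopen)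
    exact fun z hz => ⟨fun hzV => (hTsub (hVT hzV)).2 hz, hCO (hLC hz)⟩
  have hyM : y ∈ Vᶜ ∩ O ∪ W := by
    rw [h _ hM hLint]
    trivial
  rcases hyM with hyA | hyW
  · exact disjoint_left.mp hdis hyA rfl
  · exact hy hyW

theorem exists_dense_mk_eq_density (Y : Type u) [TopologicalSpace Y] :
    ∃ D : Set Y, Dense D ∧ Cardinal.mk D = density Y :=
  csInf_mem (s := {κ : Cardinal.{u} | ∃ D : Set Y, Dense D ∧ Cardinal.mk D = κ})
    ⟨_, univ, dense_univ, rfl⟩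

/-- In a `d(X)`-Baire continuum, every proper subcontinuum misses a non-block point. -/
theorem exists_isNonBlockPoint_notMem [T2Space X] (hB : IsCardinalBaire X (density X)) {K : Set X}
    (hK : IsSubcontinuum K) (hKne : K ≠ univ) : ∃ p, p ∉ K ∧ IsNonBlockPoint p := by
  by_cases h : ∀ L, IsSubcontinuum L → K ⊆ L → L ≠ univ →
      ∃ M, IsSubcontinuum M ∧ M ≠ univ ∧ L ⊆ interior M
  · exact exists_isNonBlockPoint_of_forall_subset_interior hK hKne h
  push Not at h
  obtain ⟨L, hL, hKL, hLne, hmax⟩ := h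
  have hmax' : ∀ M, IsSubcontinuum M → L ⊆ interior M → M = univ := fun M hM hLM =>
    by_contra fun hne => hmax M hM hne hLM
  by_contra! hcon
  have hblock : ∀ p, p ∉ L → ¬ IsNonBlockPoint p := fun p hp => hcon p fun hpK => hp (hKL hpK)
  obtain ⟨D, hD, hDcard⟩ := exists_dense_mk_eq_density X
  have hint : ∀ d, interior (unavoidable L d) ⊆ L := by
    intro d
    by_cases hd : d ∈ L
    · exact interior_subset.trans (unavoidable_of_mem hL hd)
    · exact interior_unavoidable_subset hL hmax' hd (hblock d hd)
  -- Every unavoidable set contains L, so `interior L` is added back to make these open sets dense;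
  -- p is then chosen off L.
  have hdense := hB D (fun d => (unavoidable L d)ᶜ ∪ interior L) hDcard fun d => by
    refine ⟨(isClosed_unavoidable L d).isOpen_compl.union isOpen_interior, ?_⟩
    rw [← compl_compl (interior L), ← compl_inter, ← interior_eq_empty_iff_dense_compl,
      interior_inter]
    refine eq_empty_of_forall_notMem fun z hz => interior_subset hz.2 ?_
    exact interior_maximal (hint d) isOpen_interior hz.1
  obtain ⟨p, hpL, hp⟩ := hdense.inter_open_nonempty Lᶜ hL.1.isOpen_compl
    (nonempty_compl.mpr hLne)
  refine hblock p hpL (isNonBlockPoint_of_dense_reachableAvoiding hL.2.nonempty (hD.mono ?_))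
  intro d hd
  refine mem_reachableAvoiding_of_notMem_unavoidable ?_
  exact (mem_iInter.mp hp ⟨d, hd⟩).resolve_right fun hpi => hpL (interior_subset hpi)

theorem isCardinalBaire_density_of_separableSpace (Y : Type u) [TopologicalSpace Y] [BaireSpace Y]
    [TopologicalSpace.SeparableSpace Y] : IsCardinalBaire Y (density Y) := by
  intro ι U hι hU
  obtain ⟨s, hs, hsd⟩ := TopologicalSpace.exists_countable_dense Y
  have hle : density Y ≤ Cardinal.mk s := csInf_le' ⟨s, hsd, rfl⟩
  have : Countable ι := by
    rw [← Cardinal.mk_le_aleph0_iff, hι]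
    exact hle.trans (Cardinal.le_aleph0_iff_set_countable.mpr hs)
  exact dense_iInter_of_isOpen (fun i => (hU i).1) fun i => (hU i).2

end HausdorffContinua

theorem mainTheorem1 (X : Type u) [TopologicalSpace X] [CompactSpace X] [ConnectedSpace X]
    [T2Space X] [Nontrivial X] :
    (HausdorffContinua.IsCardinalBaire X (HausdorffContinua.density X) →
      HausdorffContinua.IsIrreducibleAbout {p : X | HausdorffContinua.IsNonBlockPoint p} ∧
      ∃ p q : X, p ≠ q ∧ HausdorffContinua.IsNonBlockPoint p ∧
        HausdorffContinua.IsNonBlockPoint q) ∧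
    (TopologicalSpace.SeparableSpace X →
      HausdorffContinua.IsCardinalBaire X (HausdorffContinua.density X)) := by
  refine ⟨fun hB => ⟨fun K hK hsub => ?_, ?_⟩, fun _ =>
    HausdorffContinua.isCardinalBaire_density_of_separableSpace X⟩
  · by_contra hne
    obtain ⟨p, hpK, hp⟩ := HausdorffContinua.exists_isNonBlockPoint_notMem hB hK hne
    exact hpK (hsub hp)
  · have hsing : ∀ x : X, ∃ p, p ≠ x ∧ HausdorffContinua.IsNonBlockPoint p := fun x =>
      HausdorffContinua.exists_isNonBlockPoint_notMem hB (K := {x})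
        ⟨isClosed_singleton, isConnected_singleton⟩ (Set.singleton_ne_univ x)
    obtain ⟨q, -, hq⟩ := hsing (Classical.arbitrary X)
    obtain ⟨p, hpq, hp⟩ := hsing q
    exact ⟨p, q, hpq, hp, hq⟩
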